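/- Let $2\le p<\infty$, $k\ge 3$, $0<\alpha<1$. Write $\gamma_p(x)=(|x_1|^p+|x_2|^p)^{1/p}$ on $\mathbb{R}^2$. Let $U\subset\mathbb{R}^2$ be a bounded simply connected open set whose boundary is a simple closed Jordan curve made up of finitely many regular arcs that are $C^{k,\alpha}$ (for instance analytic) up to their endpoints, and suppose that at every vertex (common endpoint of consecutive arcs) the opening angle of $U$ is less than $\pi$; there may also be no vertex at all, in which case $\partial U$ is a regular closed $C^{k,\alpha}$ curve. Put $d_p(x)=\min_{y\in\partial U}\gamma_p(x-y)$, and call $y\in\partial U$ a $p$-closest point to $x$ if $\gamma_p(x-y)=d_p(x)$. The $p$-ridge $R_p$ is the complement in $U$ of the largest open subset of $U$ on which $d_p$ is (locally) $C^{1,1}$. Assume the following at every point $y_0$ of a closed arc (endpoints included) at which the normal to the arc is parallel to a coordinate axis. After interchanging the coordinates and reflecting if necessary, the arc is near $y_0=(a_0,b(0))$ parametrized by $s\mapsto(a_0+s,b(s))$ (with $s$ in a one-sided neighborhood of $0$ if $y_0$ is an endpoint), where $b'(0)=0$ and, when $y_0$ is not a vertex, $U$ lies above the arc near $y_0$. Then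 $b'(s)=c(s)|c(s)|^{p-2}$ near $0$ for some $C^{k-1,\alpha}$ function $c$ with $c(0)=0$, and $1-c'(0)\,d_p(x)\neq0$ for every $x\in U$ that has $y_0$ as its only $p$-closest point on $\partial U$. Then every point $y_0\in\partial U$ that is not a vertex has a neighborhood $W$ in $\mathbb{R}^2$ such that $W\cap U$ does not intersect $R_p$. -/

import Mathlib

open Set Filter Topology
open scoped NNReal

noncomputable section

/-- The `p`-norm `γ_p` on the plane. -/
def pNorm (p : ℝ) (x : ℝ × ℝ) : ℝ := (|x.1| ^ p + |x.2| ^ p) ^ (1 / p)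

/-- The `p`-distance `d_p(x) = d_p(x, ∂U)` to the boundary of `U`. -/
def pDist (p : ℝ) (U : Set (ℝ × ℝ)) (x : ℝ × ℝ) : ℝ :=
  sInf ((fun y => pNorm p (x - y)) '' frontier U)

/-- `y` is a `p`-closest point to `x` on `∂U`. -/
def IsPClosest (p : ℝ) (U : Set (ℝ × ℝ)) (x y : ℝ × ℝ) : Prop :=
  y ∈ frontier U ∧ pNorm p (x - y) = pDist p U x

/-- `g` is (locally) `C^{1,1}` on the open set `W`. -/
def IsC11On (g : ℝ × ℝ → ℝ) (W : Set (ℝ × ℝ)) : Prop :=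
  DifferentiableOn ℝ g W ∧ LocallyLipschitzOn W (fderiv ℝ g)

/-- The `p`-ridge: the complement in `U` of the largest open subset of `U` on which `d_p` is
`C^{1,1}`. -/
def pRidge (p : ℝ) (U : Set (ℝ × ℝ)) : Set (ℝ × ℝ) :=
  U \ ⋃₀ {W | IsOpen W ∧ W ⊆ U ∧ IsC11On (pDist p U) W}

/-- `g` is `C^{k,α}` on `s` (used for nondegenerate compact intervals `s`, so that derivatives at
the endpoints are one-sided). -/
def IsCkHolderOn {E : Type*} [NormedAddCommGroup E] [NormedSpace ℝ E]
    (k : ℕ) (α : ℝ≥0) (g : ℝ → E) (s : Set ℝ) : Prop :=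
  ContDiffOn ℝ k g s ∧ ∃ C : ℝ≥0, HolderOnWith C α (iteratedDerivWithin k g s) s

/-- `f` restricted to `[a, b]` runs along (a part of) one closed boundary arc: no vertex is met
in the interior of the interval. The endpoints may be sent to vertices. -/
def IsArc (V : Set (ℝ × ℝ)) (f : ℝ → ℝ × ℝ) (a b : ℝ) : Prop :=
  a < b ∧ ∀ t ∈ Ioo a b, f t ∉ V

/-- `U` has at `v` an opening angle less than `π`: close to `v` it is contained in a closed sector
with apex `v` and opening less than `π`. -/
def IsNonreentrant (U : Set (ℝ × ℝ)) (v : ℝ × ℝ) : Prop :=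
  ∃ (e : ℝ × ℝ) (m : ℝ), 0 < m ∧
    ∀ᶠ x in 𝓝 v, x ∈ U → m * ‖x - v‖ ≤ e.1 * (x.1 - v.1) + e.2 * (x.2 - v.2)

/-- `U` is a bounded simply connected open set whose boundary is a simple closed Jordan curve,
traversed once by the `L`-periodic map `f`, with finite set of vertices `V` (possibly empty); the
arcs between consecutive vertices are regular and `C^{k,α}` up to their endpoints, and all
vertices are nonreentrant corners. -/
structure IsPiecewiseSmoothDomain (k : ℕ) (α : ℝ≥0) (U V : Set (ℝ × ℝ)) (L : ℝ)
    (f : ℝ → ℝ × ℝ) : Prop where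
  isOpen : IsOpen U
  isBounded : Bornology.IsBounded U
  simplyConnected : IsSimplyConnected U
  period_pos : 0 < L
  periodic : Function.Periodic f L
  continuous : Continuous f
  injOn : InjOn f (Ico 0 L)
  range_eq : range f = frontier U
  finite_vertices : V.Finite
  vertices_subset : V ⊆ frontier U
  arc_smooth : ∀ a b, IsArc V f a b → IsCkHolderOn k α f (Icc a b)
  arc_regular : ∀ a b, IsArc V f a b → ∀ t ∈ Icc a b, derivWithin f (Icc a b) t ≠ 0
  nonreentrant : ∀ v ∈ V, IsNonreentrant U v

/-- The smallness condition on the curvature at the points where the normal to an arc is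
vertical. Whenever `s ↦ (a₀ + s, b s)`, `s ∈ [s₁, s₂] ∋ 0`, parametrizes a part of a closed arc
and `b'(0) = 0`, one has `b' = c |c|^{p-2}` near `0` with `c` of class `C^{k-1,α}` and `c 0 = 0`;
moreover `1 - c'(0) d_p` does not vanish at the points of `U` whose only `p`-closest boundary
point is `(a₀, b 0)`. The point may be an endpoint of the arc, in which case `0` is an endpoint of
`[s₁, s₂]`. The sign `ε` is `1` if `U` lies above the arc at that point; if `U` lies below it, the
condition is the one obtained by reflection, which replaces `b, c` by `-b, -c`.
(As the arc is `C^{k,α}` and regular, such a `b` is automatically `C^{k,α}`.) -/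
def VerticalNormalCondition (p : ℝ) (k : ℕ) (α : ℝ≥0) (U V : Set (ℝ × ℝ))
    (f : ℝ → ℝ × ℝ) : Prop :=
  ∀ t₁ t₂ : ℝ, IsArc V f t₁ t₂ →
  ∀ (a₀ s₁ s₂ : ℝ) (b : ℝ → ℝ), s₁ < s₂ → (0 : ℝ) ∈ Icc s₁ s₂ →
    ContDiffOn ℝ k b (Icc s₁ s₂) →
    MapsTo (fun s => (a₀ + s, b s)) (Icc s₁ s₂) (f '' Icc t₁ t₂) →
    derivWithin b (Icc s₁ s₂) 0 = 0 →
    ∃ (c : ℝ → ℝ) (δ : ℝ), 0 < δ ∧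
      IsCkHolderOn (k - 1) α c (Icc s₁ s₂ ∩ Icc (-δ) δ) ∧
      c 0 = 0 ∧
      (∀ s ∈ Icc s₁ s₂ ∩ Icc (-δ) δ,
        derivWithin b (Icc s₁ s₂) s = c s * |c s| ^ (p - 2)) ∧
      ∀ ε : ℝ, (ε = 1 ∨ ε = -1) →
        (∀ᶠ t in 𝓝[>] (0 : ℝ), (a₀, b 0 + ε * t) ∈ U) →
        ∀ x ∈ U, (∀ y, IsPClosest p U x y ↔ y = (a₀, b 0)) →
          1 - ε * derivWithin c (Icc s₁ s₂ ∩ Icc (-δ) δ) 0 * pDist p U x ≠ 0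

/-- The smallness condition on the curvature at all points where the normal to an arc is parallel
to one of the two coordinate axes; the horizontal case is the vertical one with the coordinates
interchanged. -/
def AxisNormalCondition (p : ℝ) (k : ℕ) (α : ℝ≥0) (U V : Set (ℝ × ℝ))
    (f : ℝ → ℝ × ℝ) : Prop :=
  VerticalNormalCondition p k α U V f ∧
  VerticalNormalCondition p k α (Prod.swap '' U) (Prod.swap '' V) (Prod.swap ∘ f)

end

/-! Near a boundary point that is not a vertex, `∂U` is, up to interchanging the coordinates, the
graph of a `C²` function `b`. The point is to write `b' = c |c|^{p-2}` with `c` of class `C¹`: where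
`b' ≠ 0` a root of `b'` will do (`exists_root_of_deriv_ne_zero`), and where `b' = 0` this is the
assumption on axis-parallel normals. Minimizing `|x₁ - s|^p + |x₂ - b s|^p` shows that `x - y` is
parallel to `(-c s, 1)` at a closest point `y = (s, b s)` (`IsPClosest.fst_sub_eq`). So `x = Ψ(s, r)
= (s - r c(s), b(s) + r)`, and at `r = 0` the Jacobian is `1 + b' c = 1 + |c|^p > 0`. Hence `Ψ` has
a local `C¹` inverse `G`, and `d_p = |r| (1 + |c(s)|^p)^{1/p}` in these coordinates
(`exists_normal_coordinates`). This formula alone gives only `C¹` off the boundary. The extra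
derivative comes from the gradient, which is `±` the dual unit conormal at the foot point, a `C¹`
function of `s` and so of `x` (`exists_isC11On_of_graph`). -/

noncomputable section

/-- A `C^n` self-map of a finite-dimensional space with injective derivative at `a` has a local
inverse of class `C^n`. -/
theorem ContDiffAt.exists_local_inverse {E : Type*} [NormedAddCommGroup E] [NormedSpace ℝ E]
    [FiniteDimensional ℝ E] {n : WithTop ℕ∞} {f : E → E} {a : E} (hf : ContDiffAt ℝ n f a)
    (hn : n ≠ 0) {f' : E →L[ℝ] E} (hf' : HasFDerivAt f f' a) (hinj : Function.Injective f') :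
    ∃ G : E → E, G (f a) = a ∧ ContDiffAt ℝ n G (f a) ∧ (∀ᶠ x in 𝓝 a, G (f x) = x) ∧
      ∀ᶠ y in 𝓝 (f a), f (G y) = y := by
  have := FiniteDimensional.complete ℝ E
  let e : E ≃L[ℝ] E :=
    (LinearEquiv.ofInjectiveEndo (f' : E →ₗ[ℝ] E) hinj).toContinuousLinearEquiv
  have he : (e : E →L[ℝ] E) = f' := by ext v; rfl
  have hfe : HasFDerivAt f (e : E →L[ℝ] E) a := by rw [he]; exact hf'
  have hs : HasStrictFDerivAt f (e : E →L[ℝ] E) a := hf.hasStrictFDerivAt' hfe hn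
  exact ⟨hf.localInverse hfe hn, hf.localInverse_apply_image hfe hn, hf.to_localInverse hfe hn,
    hs.eventually_left_inverse, hs.eventually_right_inverse⟩

/-! ### The `p`-norm and closest points -/

theorem pNorm_zero {p : ℝ} (hp : 0 < p) : pNorm p 0 = 0 := by
  simp [pNorm, Real.zero_rpow hp.ne', Real.zero_rpow (inv_pos.2 hp).ne']

theorem pNorm_nonneg (p : ℝ) (x : ℝ × ℝ) : 0 ≤ pNorm p x := by
  unfold pNorm; positivity

theorem continuous_pNorm {p : ℝ} (hp : 0 < p) : Continuous (pNorm p) := by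
  unfold pNorm
  have h : 0 ≤ 1 / p := by positivity
  exact (((continuous_fst.abs).rpow_const fun _ => Or.inr hp.le).add
    ((continuous_snd.abs).rpow_const fun _ => Or.inr hp.le)).rpow_const fun _ => Or.inr h

theorem pNorm_swap (p : ℝ) (x : ℝ × ℝ) : pNorm p x.swap = pNorm p x := by
  simp [pNorm, add_comm]

theorem norm_le_pNorm {p : ℝ} (hp : 0 < p) (x : ℝ × ℝ) : ‖x‖ ≤ pNorm p x := by
  have key : ∀ t : ℝ, |t| ^ p ≤ |x.1| ^ p + |x.2| ^ p → |t| ≤ pNorm p x := by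
    intro t ht
    have := Real.rpow_le_rpow (by positivity) ht (by positivity : (0 : ℝ) ≤ 1 / p)
    rwa [← Real.rpow_mul (abs_nonneg t), mul_one_div_cancel hp.ne', Real.rpow_one] at this
  refine max_le (key x.1 ?_) (key x.2 ?_)
  · exact le_add_of_nonneg_right (by positivity)
  · exact le_add_of_nonneg_left (by positivity)

theorem pNorm_le_pNorm_iff {p : ℝ} (hp : 0 < p) (x y : ℝ × ℝ) :
    pNorm p x ≤ pNorm p y ↔ |x.1| ^ p + |x.2| ^ p ≤ |y.1| ^ p + |y.2| ^ p :=
  Real.rpow_le_rpow_iff (by positivity) (by positivity) (by positivity)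

theorem pDist_le {p : ℝ} {U : Set (ℝ × ℝ)} {x y : ℝ × ℝ} (hy : y ∈ frontier U) :
    pDist p U x ≤ pNorm p (x - y) :=
  csInf_le ⟨0, by rintro _ ⟨z, -, rfl⟩; exact pNorm_nonneg _ _⟩ ⟨y, hy, rfl⟩

theorem exists_isPClosest {p : ℝ} (hp : 0 < p) {U : Set (ℝ × ℝ)} (hU : IsCompact (frontier U))
    (hne : (frontier U).Nonempty) (x : ℝ × ℝ) : ∃ y, IsPClosest p U x y := by
  obtain ⟨y, hy, h⟩ := hU.exists_sInf_image_eq hne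
    (f := fun y => pNorm p (x - y)) ((continuous_pNorm hp).comp (by fun_prop)).continuousOn
  exact ⟨y, hy, h.symm⟩

/-- The `p`-closest points to `x` converge to a boundary point `y₀` as `x` does. -/
theorem eventually_isPClosest_mem {p : ℝ} (hp : 0 < p) {U : Set (ℝ × ℝ)} {y₀ : ℝ × ℝ}
    (hy₀ : y₀ ∈ frontier U) {q : ℝ × ℝ → Prop} (hq : ∀ᶠ y in 𝓝 y₀, q y) :
    ∀ᶠ x in 𝓝 y₀, ∀ y, IsPClosest p U x y → q y := by
  obtain ⟨r, hr, hball⟩ := Metric.eventually_nhds_iff.1 hq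
  -- This function vanishes at `y₀` and bounds `‖y - y₀‖` for every closest point `y` to `x`.
  have hc : ContinuousAt (fun x : ℝ × ℝ => ‖x - y₀‖ + pNorm p (x - y₀)) y₀ :=
    ((continuous_norm.comp (by fun_prop)).add
      ((continuous_pNorm hp).comp (by fun_prop))).continuousAt
  have h0 : ‖y₀ - y₀‖ + pNorm p (y₀ - y₀) < r := by simpa [pNorm_zero hp] using hr
  filter_upwards [hc.eventually (gt_mem_nhds h0)] with x hx y hy
  apply hball
  have h1 : ‖x - y‖ ≤ pNorm p (x - y₀) :=
    (norm_le_pNorm hp _).trans (hy.2.le.trans (pDist_le hy₀))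
  rw [dist_eq_norm]
  calc ‖y - y₀‖ = ‖(x - y₀) - (x - y)‖ := by congr 1; abel
    _ ≤ ‖x - y₀‖ + ‖x - y‖ := norm_sub_le _ _
    _ < r := by linarith

/-! ### First-order condition and `p`-normals -/

theorem mul_abs_rpow_injective {p : ℝ} (hp : 2 ≤ p) :
    Function.Injective fun z : ℝ => z * |z| ^ (p - 2) := by
  intro z w h
  dsimp only at h
  have habs : ∀ z : ℝ, |z * |z| ^ (p - 2)| = |z| ^ (p - 1) := by
    intro z
    rw [abs_mul, abs_of_nonneg (Real.rpow_nonneg (abs_nonneg z) _)]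
    rcases eq_or_ne z 0 with rfl | hz
    · simp [Real.zero_rpow (by linarith : p - 1 ≠ 0)]
    · rw [mul_comm, ← Real.rpow_add_one (abs_pos.2 hz).ne']; congr 1; ring
  have h1 : |z| = |w| := by
    have h2 : |z| ^ (p - 1) = |w| ^ (p - 1) := by rw [← habs, ← habs, h]
    exact (Real.rpow_left_inj (abs_nonneg _) (abs_nonneg _) (by linarith)).1 h2
  rcases eq_or_ne w 0 with rfl | hw
  · simpa using h1
  · rw [h1] at h
    exact mul_right_cancel₀ (Real.rpow_pos_of_pos (abs_pos.2 hw) _).ne' h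

/-- First-order condition at a `p`-closest point where the boundary contains a graph. -/
theorem IsPClosest.fst_sub_eq {p : ℝ} (hp : 2 ≤ p) {U : Set (ℝ × ℝ)} {x : ℝ × ℝ} {s : ℝ}
    {b : ℝ → ℝ} {b' γ : ℝ} (h : IsPClosest p U x (s, b s)) (hb : HasDerivAt b b' s)
    (hb' : b' = γ * |γ| ^ (p - 2)) (hg : ∀ᶠ t in 𝓝 s, (t, b t) ∈ frontier U) :
    x.1 - s = -((x.2 - b s) * γ) := by
  have hp0 : 0 < p := by linarith
  have hmin : IsLocalMin (fun t => |x.1 - t| ^ p + |x.2 - b t| ^ p) s := by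
    filter_upwards [hg] with t ht
    have := h.2.le.trans (pDist_le (p := p) (x := x) ht)
    simpa using (pNorm_le_pNorm_iff hp0 _ _).1 this
  have h1 : HasDerivAt (fun t => x.1 - t) (-1) s := by
    simpa using (hasDerivAt_id s).const_sub x.1
  have h2 : HasDerivAt (fun t => x.2 - b t) (-b') s := hb.const_sub x.2
  have h3 := ((hasDerivAt_abs_rpow (x.1 - s) (by linarith : 1 < p)).comp s h1).add
    ((hasDerivAt_abs_rpow (x.2 - b s) (by linarith : 1 < p)).comp s h2)
  have h4 := hmin.hasDerivAt_eq_zero h3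
  -- The map `z ↦ z |z|^{p-2}` is multiplicative, so the vanishing derivative equates its values at
  -- both sides of the claim.
  apply mul_abs_rpow_injective hp
  dsimp only
  rw [abs_neg, abs_mul, Real.mul_rpow (abs_nonneg _) (abs_nonneg _)]
  have h5 : p * ((x.1 - s) * |x.1 - s| ^ (p - 2)
      + (x.2 - b s) * |x.2 - b s| ^ (p - 2) * b') = 0 := by linarith
  have h6 := (mul_eq_zero.1 h5).resolve_left hp0.ne'
  rw [hb'] at h6
  linarith

/-- The points on the `p`-normals to the graph of `b`, where `b' = c |c|^{p-2}`: the point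
`(s, b s) + r (-c s, 1)`. -/
def pNormalMap (b c : ℝ → ℝ) (q : ℝ × ℝ) : ℝ × ℝ := (q.1 - q.2 * c q.1, b q.1 + q.2)

/-- The derivative of `pNormalMap`. -/
def pNormalMapDeriv (r γ b' c' : ℝ) : ℝ × ℝ →L[ℝ] ℝ × ℝ :=
  (ContinuousLinearMap.fst ℝ ℝ ℝ - (r • (c' • ContinuousLinearMap.fst ℝ ℝ ℝ)
    + γ • ContinuousLinearMap.snd ℝ ℝ ℝ)).prod
  (b' • ContinuousLinearMap.fst ℝ ℝ ℝ + ContinuousLinearMap.snd ℝ ℝ ℝ)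

/-- The unit conormal (for the dual norm) of the graph, expressed by `γ = c s` and `b' s`. -/
def pConormal (p γ b' : ℝ) : ℝ × ℝ →L[ℝ] ℝ :=
  (1 + |γ| ^ p) ^ (1 / p - 1) •
    (ContinuousLinearMap.snd ℝ ℝ ℝ - b' • ContinuousLinearMap.fst ℝ ℝ ℝ)

theorem HasDerivAt.comp_fst {g : ℝ → ℝ} {g' : ℝ} {q : ℝ × ℝ} (h : HasDerivAt g g' q.1) :
    HasFDerivAt (fun q : ℝ × ℝ => g q.1) (g' • ContinuousLinearMap.fst ℝ ℝ ℝ) q :=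
  h.comp_hasFDerivAt q hasFDerivAt_fst

theorem hasFDerivAt_pNormalMap {b c : ℝ → ℝ} {b' c' : ℝ} {q : ℝ × ℝ}
    (hb : HasDerivAt b b' q.1) (hc : HasDerivAt c c' q.1) :
    HasFDerivAt (pNormalMap b c) (pNormalMapDeriv q.2 (c q.1) b' c') q :=
  (hasFDerivAt_fst.sub (hasFDerivAt_snd.mul hc.comp_fst)).prodMk
    (hb.comp_fst.add hasFDerivAt_snd)

theorem abs_rpow_sub_two_mul_sq {p : ℝ} (hp : 2 ≤ p) (γ : ℝ) :
    γ * |γ| ^ (p - 2) * γ = |γ| ^ p := by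
  rcases eq_or_ne γ 0 with rfl | h
  · simp [Real.zero_rpow (by linarith : p ≠ 0)]
  · have h1 : |γ| ^ p = |γ| ^ (p - 2) * |γ| ^ (2 : ℝ) := by
      rw [← Real.rpow_add (abs_pos.2 h)]; congr 1; ring
    rw [h1, Real.rpow_two, sq_abs]; ring

/-- The determinant is `1 + b' γ = 1 + |γ|^p`, which is positive whatever the sign of `γ`. -/
theorem injective_pNormalMapDeriv {p : ℝ} (hp : 2 ≤ p) {γ b' : ℝ} (c' : ℝ)
    (hb' : b' = γ * |γ| ^ (p - 2)) :
    Function.Injective (pNormalMapDeriv 0 γ b' c') := by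
  refine (injective_iff_map_eq_zero _).2 fun v hv => ?_
  have h1 : v.1 - γ * v.2 = 0 := by simpa [pNormalMapDeriv] using congrArg Prod.fst hv
  have h2 : b' * v.1 + v.2 = 0 := by simpa [pNormalMapDeriv] using congrArg Prod.snd hv
  have h3 : b' * γ = |γ| ^ p := by rw [hb', abs_rpow_sub_two_mul_sq hp]
  have h4 : 0 ≤ |γ| ^ p := by positivity
  have h5 : (1 + |γ| ^ p) * v.2 = 0 := by rw [← h3]; linear_combination h2 - b' * h1
  have h6 : v.2 = 0 := (mul_eq_zero.1 h5).resolve_left (by positivity)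
  have h7 : v.1 = 0 := by rw [h6] at h1; linarith
  exact Prod.ext h7 h6

/-- The signed `p`-distance in normal coordinates has the conormal as its gradient. -/
theorem hasFDerivAt_signed_pDist {p : ℝ} (hp : 2 ≤ p) {c : ℝ → ℝ} {b' c' : ℝ} {q : ℝ × ℝ}
    (hc : HasDerivAt c c' q.1) (hb' : b' = c q.1 * |c q.1| ^ (p - 2)) :
    HasFDerivAt (fun q : ℝ × ℝ => q.2 * (1 + |c q.1| ^ p) ^ (1 / p))
      ((pConormal p (c q.1) b').comp (pNormalMapDeriv q.2 (c q.1) b' c')) q := by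
  have hp0 : p ≠ 0 := by linarith
  have hpos : 0 < 1 + |c q.1| ^ p := by positivity
  have h1 : HasDerivAt (fun s => (1 + |c s| ^ p) ^ (1 / p)) _ q.1 :=
    (((hasDerivAt_abs_rpow (c q.1) (by linarith : 1 < p)).comp q.1 hc).const_add 1).rpow_const
      (p := 1 / p) (Or.inl hpos.ne')
  have h2 := (hasFDerivAt_snd (𝕜 := ℝ) (p := q)).mul h1.comp_fst
  refine h2.congr_fderiv ?_
  -- In the conormal applied to the derivative of `Ψ`, the terms `b' v.1` cancel; what remains is
  -- `(1 + b' γ) v.2 + r b' c' v.1`, times the scalar factor.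
  have h3 : (1 + |c q.1| ^ p) ^ (1 / p) = (1 + |c q.1| ^ p) ^ (1 / p - 1) * (1 + |c q.1| ^ p) := by
    rw [← Real.rpow_add_one hpos.ne']; congr 1; ring
  have h4 := abs_rpow_sub_two_mul_sq hp (c q.1)
  rw [← hb'] at h4
  refine ContinuousLinearMap.ext fun v => ?_
  simp only [Function.comp_apply]
  simp [pConormal, pNormalMapDeriv, -one_div]
  rw [h3, ← h4]
  rw [show p * |c q.1| ^ (p - 2) * c q.1 = p * b' by rw [hb']; ring]
  field_simp
  ring

theorem contDiffAt_pConormal {p : ℝ} (hp : 2 ≤ p) {γ b' : ℝ → ℝ} {s : ℝ}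
    (hγ : ContDiffAt ℝ 1 γ s) (hb' : ContDiffAt ℝ 1 b' s) :
    ContDiffAt ℝ 1 (fun s => pConormal p (γ s) (b' s)) s := by
  have h1 : ContDiffAt ℝ 1 (fun s => |γ s| ^ p) s :=
    (contDiff_norm_rpow (E := ℝ) (by linarith : 1 < p)).contDiffAt.comp s hγ
  have hpos : 0 < 1 + |γ s| ^ p := by positivity
  exact ((contDiffAt_const.add h1).rpow_const_of_ne hpos.ne').smul
    (contDiffAt_const.sub (hb'.smul contDiffAt_const))

theorem pNorm_normal {p : ℝ} (hp : 0 < p) (r γ : ℝ) :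
    pNorm p (-(r * γ), r) = |r| * (1 + |γ| ^ p) ^ (1 / p) := by
  have h : |-(r * γ)| ^ p + |r| ^ p = |r| ^ p * (1 + |γ| ^ p) := by
    rw [abs_neg, abs_mul, Real.mul_rpow (abs_nonneg _) (abs_nonneg _)]; ring
  rw [pNorm, h, Real.mul_rpow (by positivity) (by positivity), ← Real.rpow_mul (abs_nonneg _),
    mul_one_div_cancel hp.ne', Real.rpow_one]

/-! ### Normal coordinates and `C^{1,1}` regularity over a graph -/

/-- Where the boundary is the graph of a function `b` with `b' = c |c|^{p-2}`, the `p`-distance is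
expressed by normal coordinates `G`. -/
theorem exists_normal_coordinates {p : ℝ} (hp : 2 ≤ p) {U : Set (ℝ × ℝ)}
    (hU : IsCompact (frontier U)) {a : ℝ} {b c : ℝ → ℝ} (hb : ContDiffAt ℝ 2 b a)
    (hc : ContDiffAt ℝ 1 c a) (hbc : ∀ᶠ s in 𝓝 a, deriv b s = c s * |c s| ^ (p - 2))
    (hg : ∀ᶠ s in 𝓝 a, (s, b s) ∈ frontier U)
    (hg' : ∀ᶠ y in 𝓝 (a, b a), y ∈ frontier U → y.2 = b y.1) :
    ∃ G : ℝ × ℝ → ℝ × ℝ, G (a, b a) = (a, 0) ∧ ContDiffAt ℝ 1 G (a, b a) ∧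
      (∀ᶠ x in 𝓝 (a, b a), pNormalMap b c (G x) = x) ∧
      ∀ᶠ x in 𝓝 (a, b a), pDist p U x = |(G x).2| * (1 + |c (G x).1| ^ p) ^ (1 / p) := by
  have hp0 : 0 < p := by linarith
  have hy₀ : (a, b a) ∈ frontier U := hg.self_of_nhds
  have hb1 : ContDiffAt ℝ 1 b a := hb.of_le (by norm_num)
  have hbd : ∀ᶠ s in 𝓝 a, HasDerivAt b (deriv b s) s := by
    filter_upwards [hb1.eventually (by simp)] with s hs
    exact (hs.differentiableAt (by simp)).hasDerivAt
  have hcd : HasDerivAt c (deriv c a) a := (hc.differentiableAt (by simp)).hasDerivAt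
  have hΨ : ContDiffAt ℝ 1 (pNormalMap b c) (a, 0) := by
    have h1 : ContDiffAt ℝ 1 (fun q : ℝ × ℝ => c q.1) (a, 0) :=
      ContDiffAt.comp (f := Prod.fst) (a, (0 : ℝ)) hc contDiffAt_fst
    have h2 : ContDiffAt ℝ 1 (fun q : ℝ × ℝ => b q.1) (a, 0) :=
      ContDiffAt.comp (f := Prod.fst) (a, (0 : ℝ)) hb1 contDiffAt_fst
    exact (contDiffAt_fst.sub (contDiffAt_snd.mul h1)).prodMk (h2.add contDiffAt_snd)
  have h0 : pNormalMap b c (a, 0) = (a, b a) := by simp [pNormalMap]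
  obtain ⟨G, hG0, hG, hleft, hright⟩ := hΨ.exists_local_inverse (by simp)
    (hasFDerivAt_pNormalMap (q := (a, 0)) hbd.self_of_nhds hcd)
    (injective_pNormalMapDeriv hp _ hbc.self_of_nhds)
  rw [h0] at hG0 hG hright
  refine ⟨G, hG0, hG, hright, ?_⟩
  have hcont : ContinuousAt (fun z : (ℝ × ℝ) × (ℝ × ℝ) => (z.2.1, z.1.2 - b z.2.1))
      ((a, b a), (a, b a)) := by
    have : ContinuousAt (fun z : (ℝ × ℝ) × (ℝ × ℝ) => b z.2.1) ((a, b a), (a, b a)) :=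
      ContinuousAt.comp (f := fun z : (ℝ × ℝ) × (ℝ × ℝ) => z.2.1) (x := ((a, b a), (a, b a)))
        hb.continuousAt (by fun_prop)
    exact ContinuousAt.prodMk (by fun_prop) (ContinuousAt.sub (by fun_prop) this)
  -- The foot `y` depends on `x`, so the left inverse property is needed uniformly for `x` and `y`
  -- near the base point, with `r = x.2 - b y.1`.
  have hleft' : ∀ᶠ z : (ℝ × ℝ) × (ℝ × ℝ) in 𝓝 (a, b a) ×ˢ 𝓝 (a, b a),
      G (pNormalMap b c (z.2.1, z.1.2 - b z.2.1)) = (z.2.1, z.1.2 - b z.2.1) := by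
    rw [← nhds_prod_eq]
    exact hcont.eventually (p := fun q => G (pNormalMap b c q) = q) (by simpa using hleft)
  obtain ⟨pa, hpa, pb, hpb, hab⟩ := Filter.eventually_prod_iff.1 hleft'
  have hfst : Tendsto Prod.fst (𝓝 (a, b a)) (𝓝 a) := continuous_fst.continuousAt
  have hq := hpb.and (hg'.and ((hfst.eventually hbd).and ((hfst.eventually hbc).and
    (hfst.eventually hg.eventually_nhds))))
  filter_upwards [hpa, eventually_isPClosest_mem hp0 hy₀ hq] with x hx hxy
  obtain ⟨y, hy⟩ := exists_isPClosest hp0 hU ⟨_, hy₀⟩ x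
  obtain ⟨hy1, hy2, hy3, hy4, hy5⟩ := hxy y hy
  have hye : y = (y.1, b y.1) := Prod.ext rfl (hy2 hy.1)
  rw [hye] at hy
  have hfo := hy.fst_sub_eq hp hy3 hy4 hy5
  have hxe : pNormalMap b c (y.1, x.2 - b y.1) = x :=
    Prod.ext (by simp only [pNormalMap]; linarith) (by simp [pNormalMap])
  have hGx := hab hx hy1
  dsimp only at hGx
  rw [hxe] at hGx
  rw [hGx, ← hy.2, ← pNorm_normal hp0]
  congr 1
  exact Prod.ext hfo rfl

/-- Where the boundary is the graph of a `C²` function `b` with `b' = c |c|^{p-2}` and `c` of class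
`C¹`, the `p`-distance is `C^{1,1}` away from the boundary. -/
theorem exists_isC11On_of_graph {p : ℝ} (hp : 2 ≤ p) {U : Set (ℝ × ℝ)}
    (hU : IsCompact (frontier U)) {a : ℝ} {b c : ℝ → ℝ} (hb : ContDiffAt ℝ 2 b a)
    (hc : ContDiffAt ℝ 1 c a) (hbc : ∀ᶠ s in 𝓝 a, deriv b s = c s * |c s| ^ (p - 2))
    (hg : ∀ᶠ s in 𝓝 a, (s, b s) ∈ frontier U)
    (hg' : ∀ᶠ y in 𝓝 (a, b a), y ∈ frontier U → y.2 = b y.1) :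
    ∃ W : Set (ℝ × ℝ), IsOpen W ∧ (a, b a) ∈ W ∧ IsC11On (pDist p U) (W \ frontier U) := by
  obtain ⟨G, hG0, hG, hright, hdist⟩ := exists_normal_coordinates hp hU hb hc hbc hg hg'
  have hσ : Tendsto (fun x => (G x).1) (𝓝 (a, b a)) (𝓝 a) := by
    have : Tendsto (fun x => (G x).1) (𝓝 (a, b a)) (𝓝 (G (a, b a)).1) := hG.continuousAt.fst
    rwa [hG0] at this
  have hb1 : ContDiffAt ℝ 1 b a := hb.of_le (by norm_num)
  have hb' : ContDiffAt ℝ 1 (deriv b) a := hb.derivWithin (by norm_num)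
  have hall := (hG.eventually (by simp)).and (hright.and (hdist.and ((hσ.eventually hbc).and
    ((hσ.eventually hg).and ((hσ.eventually (hb1.eventually (by simp))).and
    ((hσ.eventually (hc.eventually (by simp))).and
    (hσ.eventually (hb'.eventually (by simp)))))))))
  obtain ⟨W, hW, hWo, haW⟩ := eventually_nhds_iff.1 hall
  refine ⟨W, hWo, haW, ?_⟩
  -- Off the boundary `r ≠ 0`, since `Ψ(s, 0)` is a boundary point; so `|r|` is locally `r` or `-r`.
  have hsign : ∀ x ∈ W \ frontier U, ∃ ε : ℝ, ∀ᶠ z in 𝓝 x, |(G z).2| = ε * (G z).2 := by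
    rintro x ⟨hx, hxU⟩
    obtain ⟨hx1, hx2, -, -, hx5, -⟩ := hW x hx
    have h0 : (G x).2 ≠ 0 := by
      intro h0
      apply hxU
      rw [← hx2]
      simpa [pNormalMap, h0] using hx5
    have ht : ContinuousAt (fun z => (G z).2) x := hx1.continuousAt.snd
    rcases h0.lt_or_gt with h | h
    · refine ⟨-1, ?_⟩
      filter_upwards [ht.eventually (gt_mem_nhds h)] with z hz
      rw [abs_of_neg hz, neg_one_mul]
    · refine ⟨1, ?_⟩
      filter_upwards [ht.eventually (lt_mem_nhds h)] with z hz
      rw [abs_of_pos hz, one_mul]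
  have hder : ∀ z ∈ W, ∀ ε : ℝ, (∀ᶠ w in 𝓝 z, |(G w).2| = ε * (G w).2) →
      HasFDerivAt (pDist p U) (ε • pConormal p (c (G z).1) (deriv b (G z).1)) z := by
    intro z hz ε hε
    obtain ⟨h1, -, -, h4, -, h6, h7, -⟩ := hW z hz
    have hGd : HasFDerivAt G (fderiv ℝ G z) z := (h1.differentiableAt (by simp)).hasFDerivAt
    have hbd := (h6.differentiableAt (by simp)).hasDerivAt
    have hcd := (h7.differentiableAt (by simp)).hasDerivAt
    -- The chain rule for `Ψ ∘ G = id` removes the derivative of `G`, which is merely continuous,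
    -- from the gradient of `d_p`.
    have hid : (pNormalMapDeriv (G z).2 (c (G z).1) (deriv b (G z).1) (deriv c (G z).1)).comp
        (fderiv ℝ G z) = ContinuousLinearMap.id ℝ (ℝ × ℝ) := by
      refine ((hasFDerivAt_pNormalMap hbd hcd).comp z hGd).unique
        ((hasFDerivAt_id z).congr_of_eventuallyEq ?_)
      filter_upwards [hWo.mem_nhds hz] with w hw using (hW w hw).2.1
    have h := ((hasFDerivAt_signed_pDist hp hcd h4).comp z hGd).const_smul ε
    rw [ContinuousLinearMap.comp_assoc, hid, ContinuousLinearMap.comp_id] at h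
    refine h.congr_of_eventuallyEq ?_
    filter_upwards [hWo.mem_nhds hz, hε] with w hw hwε
    rw [(hW w hw).2.2.1, hwε]
    simp [mul_assoc]
  refine ⟨fun x hx => ?_, fun x hx => ?_⟩
  · obtain ⟨ε, hε⟩ := hsign x hx
    exact (hder x hx.1 ε hε).differentiableAt.differentiableWithinAt
  · obtain ⟨ε, hε⟩ := hsign x hx
    obtain ⟨h1, -, -, -, -, -, h7, h8⟩ := hW x hx.1
    have hN : ContDiffAt ℝ 1
        (fun z => ε • pConormal p (c (G z).1) (deriv b (G z).1)) x := by
      have := ContDiffAt.comp (f := fun z => (G z).1) x (contDiffAt_pConormal hp h7 h8) h1.fst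
      exact this.const_smul ε
    have heq : fderiv ℝ (pDist p U) =ᶠ[𝓝 x]
        fun z => ε • pConormal p (c (G z).1) (deriv b (G z).1) := by
      filter_upwards [hWo.mem_nhds hx.1, hε.eventually_nhds] with z hz hzε
      exact (hder z hz ε hzε).fderiv
    obtain ⟨K, t, ht, hK⟩ := (hN.congr_of_eventuallyEq heq).exists_lipschitzOnWith
    exact ⟨K, t, mem_nhdsWithin_of_mem_nhds ht, hK⟩

/-! ### From a parametrized curve to a graph -/

theorem Function.Periodic.eq_of_injOn_Ico {E : Type*} {f : ℝ → E} {L : ℝ} (hf : f.Periodic L)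
    (hL : 0 < L) (hinj : InjOn f (Ico 0 L)) {s t : ℝ} (h : f s = f t) (hst : |s - t| < L) :
    s = t := by
  have hmod : ∀ u, f (toIcoMod hL 0 u) = f u := fun u => hf.sub_zsmul_eq _
  have hmem : ∀ u, toIcoMod hL 0 u ∈ Ico 0 L := fun u => by
    simpa using toIcoMod_mem_Ico hL 0 u
  have h1 : toIcoMod hL 0 s = toIcoMod hL 0 t :=
    hinj (hmem s) (hmem t) (by rw [hmod, hmod, h])
  simp only [toIcoMod, zsmul_eq_mul] at h1
  have h2 : s - t = ((toIcoDiv hL 0 s - toIcoDiv hL 0 t : ℤ) : ℝ) * L := by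
    push_cast; linarith
  rw [h2, abs_mul, abs_of_pos hL] at hst
  have h3 : |((toIcoDiv hL 0 s - toIcoDiv hL 0 t : ℤ) : ℝ)| < 1 := by
    by_contra hcon
    nlinarith [not_lt.1 hcon]
  have h4 : toIcoDiv hL 0 s - toIcoDiv hL 0 t = 0 := Int.abs_lt_one_iff.1 (by exact_mod_cast h3)
  rw [h4] at h2
  simp only [Int.cast_zero, zero_mul] at h2
  linarith

/-- A simple closed curve returns to a neighborhood of `f t₀` only for parameters near `t₀`. -/
theorem Function.Periodic.eventually_exists_parameter {E : Type*} [TopologicalSpace E] [T2Space E]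
    {f : ℝ → E} {L : ℝ} (hf : f.Periodic L) (hL : 0 < L) (hc : Continuous f)
    (hinj : InjOn f (Ico 0 L)) {t₀ : ℝ} {q : ℝ → Prop} (hq : ∀ᶠ t in 𝓝 t₀, q t) :
    ∀ᶠ y in 𝓝 (f t₀), y ∈ range f → ∃ t, q t ∧ f t = y := by
  obtain ⟨r, hr, hball⟩ := Metric.eventually_nhds_iff_ball.1 hq
  -- One full period centered at `t₀`, minus the parameters near `t₀`: its image is compact and
  -- misses `f t₀`.
  set K := Icc (t₀ - L / 2) (t₀ - L / 2 + L) \ Metric.ball t₀ r with hK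
  have hKc : IsCompact K := isCompact_Icc.diff Metric.isOpen_ball
  have hnot : f t₀ ∉ f '' K := by
    rintro ⟨t, ht, hft⟩
    have hlt : |t - t₀| < L := by
      have := ht.1.1
      have := ht.1.2
      rw [abs_lt]; constructor <;> linarith
    have := hf.eq_of_injOn_Ico hL hinj hft hlt
    exact ht.2 (this ▸ Metric.mem_ball_self hr)
  filter_upwards [(hKc.image hc).isClosed.isOpen_compl.mem_nhds hnot] with y hy hyr
  rw [← hf.image_Icc hL (t₀ - L / 2)] at hyr
  obtain ⟨t, ht, rfl⟩ := hyr
  refine ⟨t, hball t ?_, rfl⟩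
  by_contra hcon
  exact hy ⟨t, ⟨ht, hcon⟩, rfl⟩

/-- Away from `0` the map `z ↦ z |z|^{p-2}` has the smooth inverse `w ↦ ± |w|^{1/(p-1)}`. -/
theorem exists_root_of_deriv_ne_zero {p : ℝ} (hp : 2 ≤ p) {g : ℝ → ℝ} {a : ℝ}
    (hg : ContDiffAt ℝ 1 g a) (h0 : g a ≠ 0) :
    ∃ c : ℝ → ℝ, ContDiffAt ℝ 1 c a ∧ ∀ᶠ s in 𝓝 a, g s = c s * |c s| ^ (p - 2) := by
  have key : ∀ h : ℝ → ℝ, ContDiffAt ℝ 1 h a → 0 < h a →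
      ∃ c : ℝ → ℝ, ContDiffAt ℝ 1 c a ∧ ∀ᶠ s in 𝓝 a, h s = c s * |c s| ^ (p - 2) := by
    intro h hh hpos
    refine ⟨fun s => h s ^ (1 / (p - 1)), hh.rpow_const_of_ne hpos.ne', ?_⟩
    filter_upwards [hh.continuousAt.eventually (lt_mem_nhds hpos)] with s hs
    have hs' : 0 < h s ^ (1 / (p - 1)) := Real.rpow_pos_of_pos hs _
    have hp1 : p - 1 ≠ 0 := by linarith
    rw [abs_of_pos hs', mul_comm, ← Real.rpow_add_one hs'.ne', ← Real.rpow_mul hs.le,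
      show 1 / (p - 1) * (p - 2 + 1) = 1 by field_simp; ring, Real.rpow_one]
  rcases h0.lt_or_gt with h | h
  · obtain ⟨c, hc, hcs⟩ := key (fun s => -g s) hg.neg (neg_pos.2 h)
    refine ⟨fun s => -c s, hc.neg, hcs.mono fun s hs => ?_⟩
    rw [abs_neg]; linarith
  · exact key g hg h

/-- `C^{1,1}` regularity near a boundary point with nonvertical tangent. -/
theorem exists_isC11On_of_curve {p : ℝ} (hp : 2 ≤ p) {k : ℕ} (hk : 3 ≤ k) {α : ℝ≥0}
    {U V : Set (ℝ × ℝ)} {f : ℝ → ℝ × ℝ} (hA : VerticalNormalCondition p k α U V f)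
    (hU : IsCompact (frontier U)) (hf : range f = frontier U) {t₀ t₁ t₂ : ℝ}
    (harc : IsArc V f t₁ t₂) (ht₀ : t₀ ∈ Ioo t₁ t₂) (hfk : ContDiffAt ℝ k f t₀)
    (hd : (deriv f t₀).1 ≠ 0)
    (hloc : ∀ q : ℝ → Prop, (∀ᶠ t in 𝓝 t₀, q t) →
      ∀ᶠ y in 𝓝 (f t₀), y ∈ range f → ∃ t, q t ∧ f t = y) :
    ∃ W : Set (ℝ × ℝ), IsOpen W ∧ f t₀ ∈ W ∧ IsC11On (pDist p U) (W \ frontier U) := by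
  have hk0 : (k : WithTop ℕ∞) ≠ 0 := by exact_mod_cast (by omega : k ≠ 0)
  have hk2 : (2 : WithTop ℕ∞) ≤ k := by exact_mod_cast (by omega : 2 ≤ k)
  have hg : HasDerivAt (fun t => (f t).1) (deriv f t₀).1 t₀ :=
    (ContinuousLinearMap.fst ℝ ℝ ℝ).hasFDerivAt.comp_hasDerivAt t₀
      (hfk.differentiableAt hk0).hasDerivAt
  -- Inverting the first coordinate of `f` makes the arc a graph over the horizontal axis.
  obtain ⟨θ, hθ0, hθ, hleft, hright⟩ := hfk.fst.exists_local_inverse hk0 hg.hasFDerivAt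
    (fun v w h => by simpa [hd] using h)
  set a := (f t₀).1 with ha
  set β : ℝ → ℝ := fun z => (f (θ z)).2 with hβ
  have hβa : (a, β a) = f t₀ := by rw [hβ]; dsimp only; rw [hθ0]
  have hβk : ContDiffAt ℝ k β a := by
    have h1 : ContDiffAt ℝ k (fun t => (f t).2) (θ a) := by rw [hθ0]; exact hfk.snd
    exact h1.comp a hθ
  have hβ' : ContDiffAt ℝ 1 (deriv β) a := (hβk.of_le hk2).derivWithin (by norm_num)
  have hθarc : ∀ᶠ z in 𝓝 a, θ z ∈ Ioo t₁ t₂ :=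
    hθ.continuousAt.eventually (isOpen_Ioo.mem_nhds (by rwa [hθ0]))
  obtain ⟨c, hc, hβc⟩ : ∃ c : ℝ → ℝ, ContDiffAt ℝ 1 c a ∧
      ∀ᶠ s in 𝓝 a, deriv β s = c s * |c s| ^ (p - 2) := by
    by_cases h0 : deriv β a = 0
    swap
    · exact exists_root_of_deriv_ne_zero hp hβ' h0
    set b : ℝ → ℝ := fun s => β (a + s) with hb
    have hadd : Tendsto (fun s => a + s) (𝓝 0) (𝓝 a) := by
      simpa using (continuous_const_add a).tendsto 0
    have hsub : Tendsto (fun z => z - a) (𝓝 a) (𝓝 0) := by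
      have h : Continuous fun z : ℝ => z - a := by fun_prop
      simpa using h.tendsto a
    have hev := hadd.eventually ((hβk.eventually (by simp)).and (hright.and hθarc))
    obtain ⟨r, hr, hball⟩ := Metric.nhds_basis_closedBall.eventually_iff.1 hev
    rw [Real.closedBall_eq_Icc, zero_sub, zero_add] at hball
    have h0mem : (0 : ℝ) ∈ Icc (-r) r := ⟨by linarith, hr.le⟩
    have hbk : ∀ s ∈ Icc (-r) r, ContDiffAt ℝ k b s := fun s hs =>
      ContDiffAt.comp (f := fun s => a + s) s (hball hs).1 (by fun_prop)
    have hderivb : ∀ s, deriv b s = deriv β (a + s) := fun s => deriv_comp_const_add β a s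
    have hbw : ∀ s ∈ Icc (-r) r, derivWithin b (Icc (-r) r) s = deriv b s := fun s hs =>
      ((hbk s hs).differentiableAt hk0).derivWithin
        ((uniqueDiffOn_Icc (by linarith)) s hs)
    obtain ⟨c, δ, hδ, hck, -, hcb, -⟩ := hA t₁ t₂ harc a (-r) r b (by linarith) h0mem
      (fun s hs => (hbk s hs).contDiffWithinAt)
      (fun s hs => ⟨θ (a + s), Ioo_subset_Icc_self (hball hs).2.2,
        Prod.ext (hball hs).2.1 rfl⟩)
      (by rw [hbw 0 h0mem, hderivb, add_zero, h0])
    have hnhds : Icc (-r) r ∩ Icc (-δ) δ ∈ 𝓝 (0 : ℝ) :=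
      inter_mem (Icc_mem_nhds (by linarith) hr) (Icc_mem_nhds (by linarith) hδ)
    have hc1 : ContDiffAt ℝ 1 c 0 :=
      (hck.1.contDiffAt hnhds).of_le (by exact_mod_cast (by omega : 1 ≤ k - 1))
    refine ⟨fun z => c (z - a), ?_, ?_⟩
    · refine ContDiffAt.comp (f := fun z => z - a) a ?_ (by fun_prop)
      simpa using hc1
    · filter_upwards [hsub.eventually hnhds] with z hz
      have := hcb _ hz
      rw [hbw _ hz.1, hderivb] at this
      simpa using this
  have hgr : ∀ᶠ s in 𝓝 a, (s, β s) ∈ frontier U := by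
    filter_upwards [hright] with s hs
    rw [← hf]
    exact ⟨θ s, Prod.ext hs rfl⟩
  have hgr' : ∀ᶠ y in 𝓝 (a, β a), y ∈ frontier U → y.2 = β y.1 := by
    rw [hβa, ← hf]
    filter_upwards [hloc _ hleft] with y hy hyU
    obtain ⟨t, ht, rfl⟩ := hy hyU
    simp only [hβ, ht]
  obtain ⟨W, hWo, haW, hW⟩ :=
    exists_isC11On_of_graph hp hU (hβk.of_le hk2) hc hβc hgr hgr'
  exact ⟨W, hWo, hβa ▸ haW, hW⟩

/-! ### Interchanging the coordinates, and conclusion -/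

theorem frontier_image_swap (U : Set (ℝ × ℝ)) :
    frontier (Prod.swap '' U) = Prod.swap '' frontier U :=
  ((Homeomorph.prodComm ℝ ℝ).image_frontier U).symm

theorem pDist_image_swap (p : ℝ) (U : Set (ℝ × ℝ)) (x : ℝ × ℝ) :
    pDist p (Prod.swap '' U) x.swap = pDist p U x := by
  rw [pDist, pDist, frontier_image_swap, image_image]
  congr 1
  refine image_congr fun y _ => ?_
  rw [← Prod.swap_sub, pNorm_swap]

theorem IsC11On.comp_equiv {g : ℝ × ℝ → ℝ} {W : Set (ℝ × ℝ)} (h : IsC11On g W) (hW : IsOpen W)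
    (e : (ℝ × ℝ) ≃L[ℝ] (ℝ × ℝ)) : IsC11On (g ∘ e) (e ⁻¹' W) := by
  refine ⟨h.1.comp e.differentiableOn (mapsTo_preimage _ _), fun x hx => ?_⟩
  obtain ⟨K, t, ht, hK⟩ := h.2 hx
  rw [hW.nhdsWithin_eq hx] at ht
  let c : ((ℝ × ℝ) →L[ℝ] ℝ) →L[ℝ] ((ℝ × ℝ) →L[ℝ] ℝ) :=
    (ContinuousLinearMap.compL ℝ (ℝ × ℝ) (ℝ × ℝ) ℝ).flip (e : (ℝ × ℝ) →L[ℝ] (ℝ × ℝ))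
  have hfd : fderiv ℝ (g ∘ e) = c ∘ fderiv ℝ g ∘ e := by
    funext z; exact e.comp_right_fderiv
  have hlip := c.lipschitz.comp_lipschitzOnWith (hK.comp
    (e : (ℝ × ℝ) →L[ℝ] (ℝ × ℝ)).lipschitz.lipschitzOnWith (mapsTo_preimage e t))
  exact ⟨_, e ⁻¹' t, mem_nhdsWithin_of_mem_nhds (e.continuous.continuousAt ht), hfd ▸ hlip⟩

/-- Regularity makes one component of `f'` nonzero; a vertical tangent becomes horizontal after the
swap, which preserves `d_p`. -/
theorem IsPiecewiseSmoothDomain.exists_isC11On {p : ℝ} (hp : 2 ≤ p) {k : ℕ} (hk : 3 ≤ k)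
    {α : ℝ≥0} {U V : Set (ℝ × ℝ)} {L : ℝ} {f : ℝ → ℝ × ℝ}
    (hU : IsPiecewiseSmoothDomain k α U V L f) (hA : AxisNormalCondition p k α U V f)
    {y₀ : ℝ × ℝ} (hy₀ : y₀ ∈ frontier U \ V) :
    ∃ W : Set (ℝ × ℝ), IsOpen W ∧ y₀ ∈ W ∧ IsC11On (pDist p U) (W \ frontier U) := by
  have hUc : IsCompact (frontier U) :=
    Metric.isCompact_of_isClosed_isBounded isClosed_frontier
      (hU.isBounded.closure.subset frontier_subset_closure)
  obtain ⟨t₀, rfl⟩ : y₀ ∈ range f := hU.range_eq ▸ hy₀.1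
  have hk0 : (k : WithTop ℕ∞) ≠ 0 := by exact_mod_cast (by omega : k ≠ 0)
  obtain ⟨r, hr, hball⟩ := Metric.eventually_nhds_iff_ball.1
    (hU.continuous.continuousAt.eventually
      (hU.finite_vertices.isClosed.isOpen_compl.mem_nhds hy₀.2))
  rw [Real.ball_eq_Ioo] at hball
  have harc : IsArc V f (t₀ - r) (t₀ + r) := ⟨by linarith, hball⟩
  have ht₀ : t₀ ∈ Ioo (t₀ - r) (t₀ + r) := ⟨by linarith, by linarith⟩
  have hnhds : Icc (t₀ - r) (t₀ + r) ∈ 𝓝 t₀ := Icc_mem_nhds ht₀.1 ht₀.2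
  have hfk : ContDiffAt ℝ k f t₀ := (hU.arc_smooth _ _ harc).1.contDiffAt hnhds
  have hfd : HasDerivAt f (deriv f t₀) t₀ := (hfk.differentiableAt hk0).hasDerivAt
  have hd : deriv f t₀ ≠ 0 := by
    rw [← derivWithin_of_mem_nhds hnhds]
    exact hU.arc_regular _ _ harc t₀ (Ioo_subset_Icc_self ht₀)
  by_cases hd1 : (deriv f t₀).1 = 0
  swap
  · exact exists_isC11On_of_curve hp hk hA.1 hUc hU.range_eq harc ht₀ hfk hd1 fun q hq =>
      hU.periodic.eventually_exists_parameter hU.period_pos hU.continuous hU.injOn hq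
  have hd2 : (deriv f t₀).2 ≠ 0 := fun h => hd (Prod.ext hd1 h)
  let e := ContinuousLinearEquiv.prodComm ℝ ℝ ℝ
  have hes : ⇑e = Prod.swap := rfl
  have hder : deriv (Prod.swap ∘ f) t₀ = (deriv f t₀).swap :=
    ((e : (ℝ × ℝ) →L[ℝ] (ℝ × ℝ)).hasFDerivAt.comp_hasDerivAt t₀ hfd).deriv
  obtain ⟨W, hWo, hyW, hW⟩ := exists_isC11On_of_curve (f := Prod.swap ∘ f) (t₀ := t₀) hp hk hA.2
    (by rw [frontier_image_swap]; exact hUc.image continuous_swap)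
    (by rw [range_comp, frontier_image_swap, hU.range_eq])
    (t₁ := t₀ - r) (t₂ := t₀ + r)
    ⟨harc.1, fun t ht ⟨v, hv, hvt⟩ => harc.2 t ht (Prod.swap_injective hvt ▸ hv)⟩ ht₀
    (e.contDiff.contDiffAt.comp t₀ hfk) (by rw [hder]; exact hd2) fun q hq =>
      (show (Prod.swap ∘ f).Periodic L from hU.periodic.comp _).eventually_exists_parameter
        hU.period_pos (continuous_swap.comp hU.continuous)
        (Prod.swap_injective.comp_injOn hU.injOn) hq
  have h := hW.comp_equiv (hWo.sdiff isClosed_frontier) e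
  have hdist : pDist p (Prod.swap '' U) ∘ e = pDist p U := funext fun x => pDist_image_swap p U x
  rw [hdist, preimage_sdiff, frontier_image_swap, hes,
    preimage_image_eq _ Prod.swap_injective] at h
  exact ⟨Prod.swap ⁻¹' W, hWo.preimage continuous_swap, hyW, h⟩

end

theorem mainTheorem6 (p : ℝ) (hp : 2 ≤ p) (k : ℕ) (hk : 3 ≤ k)
    (α : ℝ≥0) (hα : 0 < α) (hα' : α < 1)
    (U V : Set (ℝ × ℝ)) (L : ℝ) (f : ℝ → ℝ × ℝ)
    (hU : IsPiecewiseSmoothDomain k α U V L f)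
    (hA : AxisNormalCondition p k α U V f)
    (y₀ : ℝ × ℝ) (hy₀ : y₀ ∈ frontier U \ V) :
    ∃ W : Set (ℝ × ℝ), IsOpen W ∧ y₀ ∈ W ∧ Disjoint (W ∩ U) (pRidge p U) := by
  obtain ⟨W, hWo, hyW, hW⟩ := hU.exists_isC11On hp hk hA hy₀
  have hsub : W ∩ U ⊆ W \ frontier U := fun x hx =>
    ⟨hx.1, fun h => (hU.isOpen.frontier_eq ▸ h).2 hx.2⟩
  refine ⟨W, hWo, hyW, disjoint_left.2 fun x hx hxR => hxR.2 ?_⟩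
  exact ⟨W ∩ U, ⟨hWo.inter hU.isOpen, inter_subset_right, hW.1.mono hsub, hW.2.mono hsub⟩, hx⟩
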